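/- Let $H$ be a real or complex Hilbert space, and let $A,B$ be bounded linear operators on $H$ that are positive (self-adjoint with $\langle Ax,x\rangle\ge 0$ and $\langle Bx,x\rangle\ge 0$ for all $x\in H$) and invertible. For $f:H\to\mathbb R\cup\{\pm\infty\}$ and $u\in H^*$ (the topological dual) let $f^*(u)=\sup_{x\in H}\{\operatorname{Re}\langle u,x\rangle-f(x)\}$ be the Fenchel conjugate; for a functional $h$ on $H^*$ let, in the same way, $h^*(x)=\sup_{u\in H^*}\{\operatorname{Re}\langle u,x\rangle-h(u)\}$, $x\in H$. For convex lower semicontinuous proper functionals $f,g$ on $H$ and $0<t<1$, $0<s<1$ put $$f\,!_t\,g=\big((1-t)f^*+tg^*\big)^*,\qquad f\,\sharp_s\,g=\frac{\sin(\pi s)}{\pi}\int_0^1\frac{t^{s-1}}{(1-t)^s}\,f\,!_t\,g\;dt,\qquad L(f,g)=\int_0^1 f\,\sharp_t\,g\;dt,$$ the integrals being taken pointwise, with values in the extended reals. Let $\mathcal Q_A(x)=\tfrac12\langle Ax,x\rangle$ for $x\in H$, and for $t\in[0,1]$ let $A\sharp_tB=A^{1/2}\big(A^{-1/2}BA^{-1/2}\big)^tA^{1/2}$.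 Then $t\mapsto A\sharp_tB$ is integrable on $[0,1]$ in the operator norm, and with $L(A,B)=\int_0^1A\sharp_tB\,dt$ we have $$L(\mathcal Q_A,\mathcal Q_B)=\mathcal Q_{L(A,B)}$$ (equality of functionals on $H$), and $$L(A,B)=A^{1/2}\,F\big(A^{-1/2}BA^{-1/2}\big)A^{1/2},$$ where $F(x)=\frac{x-1}{\log x}$ for $x>0$, $x\ne1$, and $F(1)=1$, and $F(\cdot)$ is understood through the continuous functional calculus. -/

import Mathlib

/-!
## Continuous functional calculus on a real or complex Hilbert space

Mathlib provides the continuous functional calculus of self-adjoint bounded operators on complex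
Hilbert spaces. Here it is established for a Hilbert space over `𝕜 = ℝ` or `𝕜 = ℂ`, so that real
powers `A ^ r` and `cfc F A` are Mathlib's notions in both cases.
-/

namespace LogMean

section FunctionalCalculus

open Polynomial

variable {𝕜 H : Type*} [RCLike 𝕜] [NormedAddCommGroup H] [InnerProductSpace 𝕜 H]
  [CompleteSpace H] [NormedSpace ℝ H] [IsScalarTower ℝ 𝕜 H]

theorem isSelfAdjoint_algebraMap (r : ℝ) : IsSelfAdjoint (algebraMap ℝ (H →L[𝕜] H) r) := by
  have : algebraMap ℝ (H →L[𝕜] H) r = algebraMap 𝕜 (H →L[𝕜] H) (r : 𝕜) := by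
    ext x
    rw [ContinuousLinearMap.algebraMap_apply, ContinuousLinearMap.algebraMap_apply,
      RCLike.real_smul_eq_coe_smul (K := 𝕜)]
  rw [this, IsSelfAdjoint, ← algebraMap_star_comm]
  simp

theorem isSelfAdjoint_aeval {T : H →L[𝕜] H} (hT : IsSelfAdjoint T) (p : ℝ[X]) :
    IsSelfAdjoint (aeval T p) := by
  induction p using Polynomial.induction_on' with
  | add p q hp hq => rw [map_add]; exact hp.add hq
  | monomial n a =>
    rw [aeval_monomial]
    have h1 := isSelfAdjoint_algebraMap (𝕜 := 𝕜) (H := H) a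
    have h2 := hT.pow n
    exact h1.commute_iff h2 |>.mp (Algebra.commutes a _)

theorem isUnit_sq_add {T : H →L[𝕜] H} (hT : IsSelfAdjoint T) {c : ℝ} (hc : 0 < c) :
    IsUnit (T ^ 2 + algebraMap ℝ (H →L[𝕜] H) c) := by
  refine ContinuousLinearMap.isUnit_of_forall_le_norm_inner_map _ (c := ⟨c, hc.le⟩) hc fun x => ?_
  have h1 : inner 𝕜 ((T ^ 2 + algebraMap ℝ (H →L[𝕜] H) c) x) x
      = ((‖T x‖ ^ 2 + c * ‖x‖ ^ 2 : ℝ) : 𝕜) := by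
    have h2 : inner 𝕜 (T (T x)) x = inner 𝕜 (T x) (T x) := by
      rw [← ContinuousLinearMap.adjoint_inner_right, hT.adjoint_eq]
    simp only [add_apply, inner_add_left, pow_two,
      mul_apply_eq_comp, h2, ContinuousLinearMap.algebraMap_apply,
      RCLike.real_smul_eq_coe_smul (K := 𝕜), inner_smul_left, inner_self_eq_norm_sq_to_K]
    push_cast
    simp
  rw [h1, RCLike.norm_ofReal, abs_of_nonneg (by positivity)]
  change ‖x‖ ^ 2 * c ≤ _
  nlinarith [sq_nonneg ‖T x‖]

theorem exists_root_of_irreducible {T : H →L[𝕜] H} (hT : IsSelfAdjoint T) {q : ℝ[X]}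
    (hq : Irreducible q) (hu : ¬ IsUnit (aeval T q)) : ∃ μ ∈ spectrum ℝ T, q.eval μ = 0 := by
  by_cases hr : ∃ μ, q.IsRoot μ
  · obtain ⟨μ, hμ⟩ := hr
    refine ⟨μ, ?_, hμ⟩
    obtain ⟨u, hu'⟩ := (irreducible_X_sub_C μ).associated_of_dvd hq (dvd_iff_isRoot.mpr hμ)
    rw [← hu', map_mul] at hu
    intro h
    refine hu (IsUnit.mul ?_ (u.isUnit.map _))
    rw [map_sub, aeval_X, aeval_C, IsUnit.sub_iff]
    exact h
  · push Not at hr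
    exfalso
    apply hu
    have hd := hq.degree_le_two
    obtain ⟨a, b, c, rfl⟩ : ∃ a b c : ℝ, q = C a * X ^ 2 + C b * X + C c :=
      ⟨_, _, _, eq_quadratic_of_degree_le_two hd⟩
    have ha : a ≠ 0 := by
      rintro rfl
      by_cases hb : b = 0
      · subst hb
        simp only [map_zero, zero_mul, zero_add] at hq
        by_cases hc : c = 0
        · subst hc; simp at hq
        · exact hq.not_isUnit (isUnit_C.mpr (isUnit_iff_ne_zero.mpr hc))
      · exact hr (-c / b) (by simp [IsRoot.def]; field_simp; ring)
    have hD : discrim a b c < 0 := by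
      by_contra! h
      obtain ⟨x, hx⟩ := exists_quadratic_eq_zero ha ⟨√(discrim a b c), (Real.mul_self_sqrt h).symm⟩
      exact hr x (by simp [IsRoot.def]; linarith)
    have hk : 0 < -(discrim a b c) / (4 * a ^ 2) := by
      apply div_pos <;> [linarith; positivity]
    have key : (C a * X ^ 2 + C b * X + C c : ℝ[X])
        = C a * ((X + C (b / (2 * a))) ^ 2 + C (-(discrim a b c) / (4 * a ^ 2))) := by
      have e1 : b = 2 * a * (b / (2 * a)) := by field_simp
      have e2 : c = a * (b / (2 * a)) ^ 2 + a * (-(discrim a b c) / (4 * a ^ 2)) := by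
        rw [discrim]; field_simp; ring
      generalize b / (2 * a) = s at *
      generalize -(discrim a b c) / (4 * a ^ 2) = t at *
      rw [e2, e1]
      simp only [map_add, map_mul, map_pow, C_ofNat]
      ring
    rw [key, map_mul, map_add, map_pow, aeval_C, aeval_C]
    exact IsUnit.mul ((isUnit_iff_ne_zero.mpr ha).map _)
      (isUnit_sq_add (isSelfAdjoint_aeval hT _) hk)

theorem exists_norm_le {T : H →L[𝕜] H} (hT : IsSelfAdjoint T) [Nontrivial (H →L[𝕜] H)] :
    ∃ l ∈ spectrum ℝ T, ‖T‖ ≤ |l| := by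
  by_contra! hne
  have hm : ∀ l : ℝ, ‖T‖ = |l| → IsUnit (algebraMap ℝ (H →L[𝕜] H) l - T) := fun l hl => by
    by_contra h
    exact absurd (hne l h) (by rw [hl]; exact lt_irrefl _)
  have h1 := hm ‖T‖ (by simp)
  have h2 := hm (-‖T‖) (by simp)
  have h0 : T ≠ 0 := by
    rintro rfl
    simp at h1
  have hT0 : 0 < ‖T‖ := norm_pos_iff.mpr h0
  have hu : IsUnit (T ^ 2 - algebraMap ℝ (H →L[𝕜] H) (‖T‖ ^ 2)) := by
    have h3 := h1.mul h2
    have : (algebraMap ℝ (H →L[𝕜] H) ‖T‖ - T) * (algebraMap ℝ (H →L[𝕜] H) (-‖T‖) - T)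
        = T ^ 2 - algebraMap ℝ (H →L[𝕜] H) (‖T‖ ^ 2) := by
      have hc := Algebra.commutes (A := H →L[𝕜] H) ‖T‖ T
      rw [map_neg, map_pow, sub_mul, mul_sub, mul_sub, mul_neg, mul_neg, hc]
      noncomm_ring
    rwa [this] at h3
  obtain ⟨u, hu⟩ := hu
  set R : H →L[𝕜] H := ((u⁻¹ : (H →L[𝕜] H)ˣ) : H →L[𝕜] H) with hR
  have hRpos : 0 < ‖R‖ := norm_pos_iff.mpr (Units.ne_zero _)
  have hx : ∀ x, ‖x‖ ≤ ‖R‖ * ‖T (T x) - (‖T‖ ^ 2) • x‖ := fun x => by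
    have e : R ((u : H →L[𝕜] H) x) = x := by
      rw [← mul_apply_eq_comp, hR, Units.inv_mul]
      rfl
    have e2 : (u : H →L[𝕜] H) x = T (T x) - (‖T‖ ^ 2) • x := by
      rw [hu]
      simp [pow_two, smul_smul]
    calc ‖x‖ = ‖R ((u : H →L[𝕜] H) x)‖ := by rw [e]
      _ ≤ ‖R‖ * ‖(u : H →L[𝕜] H) x‖ := R.le_opNorm _
      _ = _ := by rw [e2]
  have hsq : ∀ x, ‖T (T x) - (‖T‖ ^ 2) • x‖ ^ 2 ≤ ‖T‖ ^ 2 * (‖T‖ ^ 2 * ‖x‖ ^ 2 - ‖T x‖ ^ 2) := by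
    intro x
    have h2 : inner 𝕜 (T (T x)) x = inner 𝕜 (T x) (T x) := by
      rw [← ContinuousLinearMap.adjoint_inner_right, hT.adjoint_eq]
    have h3 : RCLike.re (inner 𝕜 (T (T x)) ((‖T‖ ^ 2) • x)) = ‖T‖ ^ 2 * ‖T x‖ ^ 2 := by
      rw [RCLike.real_smul_eq_coe_smul (K := 𝕜), inner_smul_right, h2, inner_self_eq_norm_sq_to_K]
      norm_cast
    rw [norm_sub_sq (𝕜 := 𝕜), h3, norm_smul, Real.norm_of_nonneg (by positivity)]
    have h4 : ‖T (T x)‖ ^ 2 ≤ (‖T‖ * ‖T x‖) ^ 2 := by gcongr; exact T.le_opNorm _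
    nlinarith
  have hlt : ∀ x, ‖T x‖ ^ 2 ≤ (‖T‖ ^ 2 - 1 / (‖R‖ ^ 2 * ‖T‖ ^ 2)) * ‖x‖ ^ 2 := by
    intro x
    have h5 : ‖x‖ ^ 2 ≤ ‖R‖ ^ 2 * (‖T‖ ^ 2 * (‖T‖ ^ 2 * ‖x‖ ^ 2 - ‖T x‖ ^ 2)) := by
      calc ‖x‖ ^ 2 ≤ (‖R‖ * ‖T (T x) - (‖T‖ ^ 2) • x‖) ^ 2 := by gcongr; exact hx x
        _ = ‖R‖ ^ 2 * ‖T (T x) - (‖T‖ ^ 2) • x‖ ^ 2 := by ring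
        _ ≤ _ := by gcongr; exact hsq x
    have h6 : ‖x‖ ^ 2 / (‖R‖ ^ 2 * ‖T‖ ^ 2) ≤ ‖T‖ ^ 2 * ‖x‖ ^ 2 - ‖T x‖ ^ 2 := by
      rw [div_le_iff₀ (by positivity)]
      linarith
    have h7 : (‖T‖ ^ 2 - 1 / (‖R‖ ^ 2 * ‖T‖ ^ 2)) * ‖x‖ ^ 2
      = ‖T‖ ^ 2 * ‖x‖ ^ 2 - ‖x‖ ^ 2 / (‖R‖ ^ 2 * ‖T‖ ^ 2) := by ring
    linarith
  have hδ : 0 < 1 / (‖R‖ ^ 2 * ‖T‖ ^ 2) := by positivity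
  set K := ‖T‖ ^ 2 - 1 / (‖R‖ ^ 2 * ‖T‖ ^ 2) with hK
  have h8 : ‖T‖ ≤ √K := by
    refine T.opNorm_le_bound (Real.sqrt_nonneg _) fun x => ?_
    rw [← Real.sqrt_sq (norm_nonneg x), ← Real.sqrt_mul' _ (by positivity)]
    exact Real.le_sqrt_of_sq_le (hlt x)
  have h9 : √K < ‖T‖ := (Real.sqrt_lt' hT0).mpr (by linarith)
  exact absurd h8 (not_le.mpr h9)

theorem spectrum_aeval_subset {T : H →L[𝕜] H} (hT : IsSelfAdjoint T) (p : ℝ[X]) {l : ℝ}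
    (hl : l ∈ spectrum ℝ (aeval T p)) : ∃ μ ∈ spectrum ℝ T, p.eval μ = l := by
  have main : ∀ q : ℝ[X], ¬ IsUnit (aeval T q) → q ≠ 0 → ∃ μ ∈ spectrum ℝ T, q.eval μ = 0 := by
    intro q
    induction q using WfDvdMonoid.induction_on_irreducible with
    | zero => simp
    | unit u hu => intro h; exact absurd (hu.map _) h
    | mul a i ha hi ih =>
      intro h _
      rw [map_mul] at h
      by_cases h1 : IsUnit (aeval T i)
      · obtain ⟨μ, hμ, h0⟩ := ih (fun h2 => h (h1.mul h2)) ha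
        exact ⟨μ, hμ, by simp [h0]⟩
      · obtain ⟨μ, hμ, h0⟩ := exists_root_of_irreducible hT hi h1
        exact ⟨μ, hμ, by simp [h0]⟩
  have h1 : ¬ IsUnit (aeval T (C l - p)) := by
    rw [map_sub, aeval_C]
    exact hl
  by_cases h0 : C l - p = 0
  · rw [sub_eq_zero] at h0
    subst h0
    by_contra! hne
    rw [sub_self, map_zero, isUnit_zero_iff] at h1
    have : Nontrivial (H →L[𝕜] H) := ⟨0, 1, h1⟩
    obtain ⟨μ, hμ, -⟩ := exists_norm_le hT
    exact hne μ hμ (by simp)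
  · obtain ⟨μ, hμ, h2⟩ := main _ h1 h0
    exact ⟨μ, hμ, (sub_eq_zero.mp (by simpa using h2)).symm⟩


theorem isCompact_spectrum (T : H →L[𝕜] H) : CompactSpace (spectrum ℝ T) := by
  let _ : NormedAlgebra ℝ (H →L[𝕜] H) :=
    { (inferInstance : Algebra ℝ (H →L[𝕜] H)) with norm_smul_le := fun r x => norm_smul_le r x }
  exact isCompact_iff_compactSpace.mp (spectrum.isCompact T)

theorem norm_aeval_le {T : H →L[𝕜] H} (hT : IsSelfAdjoint T) [CompactSpace (spectrum ℝ T)]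
    (p : ℝ[X]) : ‖aeval T p‖ ≤ 1 * ‖toContinuousMapOnAlgHom (spectrum ℝ T) p‖ := by
  rw [one_mul]
  rcases subsingleton_or_nontrivial (H →L[𝕜] H) with h | h
  · rw [Subsingleton.elim (aeval T p) 0, norm_zero]
    exact norm_nonneg _
  · obtain ⟨l, hl, hle⟩ := exists_norm_le (isSelfAdjoint_aeval hT p)
    obtain ⟨μ, hμ, rfl⟩ := spectrum_aeval_subset hT p hl
    exact hle.trans ((toContinuousMapOnAlgHom (spectrum ℝ T) p).norm_coe_le_norm ⟨μ, hμ⟩)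

theorem exists_cfc {T : H →L[𝕜] H} (hT : IsSelfAdjoint T) :
    ∃ φ : C(spectrum ℝ T, ℝ) →⋆ₐ[ℝ] (H →L[𝕜] H), Continuous φ ∧ Function.Injective φ ∧
      φ ((ContinuousMap.id ℝ).restrict <| spectrum ℝ T) = T ∧
      (∀ f, spectrum ℝ (φ f) = Set.range f) ∧ ∀ f, IsSelfAdjoint (φ f) := by
  have := isCompact_spectrum T
  set e := toContinuousMapOnAlgHom (spectrum ℝ T) with he
  have hd : DenseRange e := by
    have h1 := polynomialFunctions.topologicalClosure (spectrum ℝ T)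
    rw [DenseRange, ← polynomialFunctions_coe, dense_iff_closure_eq,
      ← Subalgebra.topologicalClosure_coe, h1]
    rfl
  let Φ : C(spectrum ℝ T, ℝ) →L[ℝ] (H →L[𝕜] H) :=
    (aeval (R := ℝ) T).toLinearMap.extendOfNorm e.toLinearMap
  have hΦ : ∀ p : ℝ[X], Φ (e p) = aeval T p := fun p =>
    LinearMap.extendOfNorm_eq hd ⟨1, norm_aeval_le hT⟩ p
  have hmul : ∀ f g, Φ (f * g) = Φ f * Φ g := fun f g => by
    induction f, g using hd.induction_on₂ with
    | hp => exact isClosed_eq (by fun_prop) (by fun_prop)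
    | h p q => rw [← map_mul, hΦ, hΦ, hΦ, map_mul]
  have hsa : ∀ f, IsSelfAdjoint (Φ f) := fun f => by
    induction f using hd.induction_on with
    | hp => exact isClosed_eq (by fun_prop) (by fun_prop)
    | ih p => rw [hΦ]; exact isSelfAdjoint_aeval hT p
  have hone : Φ 1 = 1 := by rw [← map_one e, hΦ, map_one]
  have halg : ∀ r, Φ (algebraMap ℝ _ r) = algebraMap ℝ _ r := fun r => by
    rw [Algebra.algebraMap_eq_smul_one, map_smul, hone, Algebra.algebraMap_eq_smul_one]
  let φ : C(spectrum ℝ T, ℝ) →⋆ₐ[ℝ] (H →L[𝕜] H) :=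
    { toFun := Φ
      map_one' := hone
      map_mul' := hmul
      map_zero' := map_zero Φ
      map_add' := map_add Φ
      commutes' := halg
      map_star' := fun f => by
        rw [(hsa f).star_eq, star_trivial] }
  have hspec : ∀ f, spectrum ℝ (φ f) = Set.range f := by
    intro f
    refine Set.Subset.antisymm ?_ ?_
    · exact (AlgHom.spectrum_apply_subset φ f).trans (ContinuousMap.spectrum_eq_range f).le
    · rintro _ ⟨μ, rfl⟩ hu
      change IsUnit (algebraMap ℝ _ (f μ) - Φ f) at hu
      have hopen : IsOpen {g : C(spectrum ℝ T, ℝ) | IsUnit (algebraMap ℝ (H →L[𝕜] H) (g μ) - Φ g)} := by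
        refine Units.isOpen.preimage (f := fun g : C(spectrum ℝ T, ℝ) =>
          algebraMap ℝ (H →L[𝕜] H) (g μ) - Φ g) ?_
        simp_rw [Algebra.algebraMap_eq_smul_one]
        fun_prop
      obtain ⟨p, hp⟩ := hd.exists_mem_open hopen ⟨f, hu⟩
      have h1 : p.eval (μ : ℝ) ∈ spectrum ℝ (aeval T p) :=
        spectrum.subset_polynomial_aeval T p ⟨μ, μ.2, rfl⟩
      apply h1
      have h2 : IsUnit (algebraMap ℝ (H →L[𝕜] H) (e p μ) - Φ (e p)) := hp
      rw [hΦ] at h2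
      exact h2
  refine ⟨φ, Φ.continuous, ?_, ?_, hspec, hsa⟩
  · rw [injective_iff_map_eq_zero]
    intro f hf
    have h1 := hspec f
    rw [hf] at h1
    ext μ
    have h2 : f μ ∈ spectrum ℝ (0 : H →L[𝕜] H) := h1 ▸ ⟨μ, rfl⟩
    by_contra h3
    apply h2
    rw [spectrum.mem_resolventSet_iff, sub_zero]
    exact (isUnit_iff_ne_zero.mpr h3).map _
  · have h1 : (ContinuousMap.id ℝ).restrict (spectrum ℝ T) = e X := by
      ext μ
      simp [he]
    change Φ _ = T
    rw [h1, hΦ, aeval_X]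

instance instContinuousFunctionalCalculus :
    ContinuousFunctionalCalculus ℝ (H →L[𝕜] H) IsSelfAdjoint where
  predicate_zero := .zero _
  compactSpace_spectrum := isCompact_spectrum
  spectrum_nonempty _ hT := (exists_norm_le hT).imp fun _ h => h.1
  exists_cfc_of_predicate _ hT := exists_cfc hT

instance instStarOrderedRing : StarOrderedRing (H →L[𝕜] H) := ContinuousLinearMap.instStarOrderedRingRCLike

end FunctionalCalculus

/-! ## Means of functionals -/

section Functionals

variable (𝕜 : Type*) [RCLike 𝕜] {E : Type*} [AddCommGroup E] [Module 𝕜 E] [TopologicalSpace E]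

/-- The Fenchel conjugate `f* (u) = sup_{x ∈ E} (Re ⟨u, x⟩ - f x)`, a functional on the topological
dual of `E`. -/
noncomputable def conjugate (f : E → EReal) (u : StrongDual 𝕜 E) : EReal :=
  ⨆ x : E, (((RCLike.re (u x) : ℝ) : EReal) - f x)

/-- The Fenchel conjugate of a functional `h` on the topological dual of `E`, taken with respect to
the duality between `E` and its dual: `h* (x) = sup_{u ∈ E*} (Re ⟨u, x⟩ - h u)`, a functional
on `E`. -/
noncomputable def dualConjugate (h : StrongDual 𝕜 E → EReal) (x : E) : EReal :=
  ⨆ u : StrongDual 𝕜 E, (((RCLike.re (u x) : ℝ) : EReal) - h u)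

/-- The integral over `s ⊆ ℝ` of an extended real valued function with respect to Lebesgue measure:
the integral of the positive part minus the integral of the negative part, with the convention
`(+∞) - (+∞) = +∞`. -/
noncomputable def extIntegral (s : Set ℝ) (φ : ℝ → EReal) : EReal :=
  open Classical in
  if ∫⁻ t in s, (φ t).toENNReal = ⊤ then ⊤
  else ((∫⁻ t in s, (φ t).toENNReal : ENNReal) : EReal)
    - ((∫⁻ t in s, (-φ t).toENNReal : ENNReal) : EReal)

/-- The weighted harmonic mean `f !_t g = ((1 - t) f* + t g*)*` for `0 < t < 1`, extended by
`f !_0 g = f` and `f !_1 g = g`. (If `f` and `g` are proper, then `f*` and `g*` do not take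
the value `-∞`, so that no convention for the sum `(+∞) + (-∞)` is involved.) -/
noncomputable def funHarmMean (f g : E → EReal) (t : ℝ) : E → EReal :=
  open Classical in
  if t = 0 then f else if t = 1 then g
  else dualConjugate 𝕜 fun u =>
    ((1 - t : ℝ) : EReal) * conjugate 𝕜 f u + ((t : ℝ) : EReal) * conjugate 𝕜 g u

/-- The weighted geometric mean
`f ♯_s g = (sin (π s) / π) ∫₀¹ t^(s-1) / (1-t)^s (f !_t g) dt` for `0 < s < 1`, extended by
`f ♯_0 g = f` and `f ♯_1 g = g`. -/
noncomputable def funGeoMean (f g : E → EReal) (s : ℝ) : E → EReal :=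
  open Classical in
  if s = 0 then f else if s = 1 then g
  else fun x => ((Real.sin (Real.pi * s) / Real.pi : ℝ) : EReal) *
    extIntegral (Set.Ioo 0 1) fun t =>
      ((t ^ (s - 1) / (1 - t) ^ s : ℝ) : EReal) * funHarmMean 𝕜 f g t x

/-- The logarithmic mean of two functionals, `L(f, g) = ∫₀¹ f ♯_t g dt` pointwise. -/
noncomputable def funLogMean (f g : E → EReal) (x : E) : EReal :=
  extIntegral (Set.Ioo 0 1) fun t => funGeoMean 𝕜 f g t x

end Functionals

/-! ## Quadratic functionals and means of operators -/

section Operators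

variable {𝕜 H : Type*} [RCLike 𝕜] [NormedAddCommGroup H] [InnerProductSpace 𝕜 H]

/-- The quadratic functional `x ↦ (1/2) ⟨A x, x⟩` generated by `A`, as an extended real valued
functional (for self-adjoint `A` the number `⟨A x, x⟩` is real). -/
noncomputable def quadFun (A : H →L[𝕜] H) (x : H) : EReal :=
  ((1 / 2 * RCLike.re (inner 𝕜 (A x) x) : ℝ) : EReal)

variable [CompleteSpace H] [NormedSpace ℝ H] [IsScalarTower ℝ 𝕜 H]

/-- The weighted operator geometric mean
`A ♯_t B = A^(1/2) (A^(-1/2) B A^(-1/2))^t A^(1/2)`. -/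
noncomputable def opGeoMean (A B : H →L[𝕜] H) (t : ℝ) : H →L[𝕜] H :=
  A ^ (1 / 2 : ℝ) * (A ^ (-(1 / 2) : ℝ) * B * A ^ (-(1 / 2) : ℝ)) ^ t * A ^ (1 / 2 : ℝ)

/-- The operator logarithmic mean `L(A, B) = ∫₀¹ A ♯_t B dt` (Bochner integral in the space of
bounded operators). -/
noncomputable def opLogMean (A B : H →L[𝕜] H) : H →L[𝕜] H :=
  ∫ t in (0 : ℝ)..1, opGeoMean A B t

/-- The function `F(x) = (x - 1) / log x` for `x > 0`, `x ≠ 1`, with `F(1) = 1`. -/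
noncomputable def logMeanFun (x : ℝ) : ℝ :=
  open Classical in if x = 1 then 1 else (x - 1) / Real.log x

end Operators

end LogMean

namespace LogMean

open MeasureTheory Set

/-! ### Scalar identities: a Beta integral, and the means of `1` and `x`. -/

section ScalarIntegrals

/-! Under the Riesz identification the conjugate of a quadratic functional is the quadratic
functional of the inverse operator. Hence the harmonic mean of the functionals of `A` and `B` is
that of `((1-t)A⁻¹ + tB⁻¹)⁻¹`. With `X = A^(-1/2) B A^(-1/2)` this operator equals `A^(1/2) h_t(X)
A^(1/2)`, where `h_t(x) = x / ((1-t)x + t)` (`funHarmMean_quadFun_eq`).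

Every mean thus has the form `A^(1/2) f(X) A^(1/2)`, and the rest is integration of `f` over a
parameter. Such integrals commute with the functional calculus (`integrableOn_opMean`) and with the
bounded real-linear map `T ↦ (1/2) Re ⟨T x, x⟩` (`quadCLM`).

Two scalar identities for `x > 0` remain. The integral of `t^(s-1) (1-t)^(-s) h_t(x)` over `(0,1)`
is `(π / sin πs) x^s`, a Beta integral after a change of variable. The integral of `x^t` over
`(0,1)` is `F(x)`. -/

/-- This is `B(s, 1-s) = Γ(s) Γ(1-s)`, evaluated by the reflection formula. -/
theorem integral_rpow_div_rpow_one_sub {s : ℝ} (hs0 : 0 < s) (hs1 : s < 1) :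
    ∫ t in Ioo (0 : ℝ) 1, t ^ (s - 1) / (1 - t) ^ s = Real.pi / Real.sin (Real.pi * s) := by
  have h1 : Complex.betaIntegral s ((1 - s : ℝ) : ℂ)
      = ((∫ t in Ioo (0 : ℝ) 1, t ^ (s - 1) / (1 - t) ^ s : ℝ) : ℂ) := by
    rw [Complex.betaIntegral, intervalIntegral.integral_of_le zero_le_one,
      integral_Ioc_eq_integral_Ioo, ← integral_complex_ofReal]
    refine setIntegral_congr_fun measurableSet_Ioo fun t ht => ?_
    have h2 : (0 : ℝ) ≤ 1 - t := sub_nonneg.mpr ht.2.le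
    have h3 : ((1 - s : ℝ) : ℂ) - 1 = ((-s : ℝ) : ℂ) := by push_cast; ring
    have h4 : (s : ℂ) - 1 = ((s - 1 : ℝ) : ℂ) := by push_cast; ring
    have h5 : (1 : ℂ) - t = ((1 - t : ℝ) : ℂ) := by push_cast; ring
    simp only [h3, h4, h5, ← Complex.ofReal_cpow ht.1.le, ← Complex.ofReal_cpow h2,
      Real.rpow_neg h2]
    push_cast
    rw [div_eq_mul_inv]
  have h2 := ProbabilityTheory.beta_eq_betaIntegralReal s (1 - s) hs0 (sub_pos.mpr hs1)
  rw [h1, Complex.ofReal_re, ProbabilityTheory.beta, add_sub_cancel, Real.Gamma_one, div_one,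
    Real.Gamma_mul_Gamma_one_sub] at h2
  exact h2.symm

theorem sin_pi_mul_pos {s : ℝ} (hs0 : 0 < s) (hs1 : s < 1) : 0 < Real.sin (Real.pi * s) :=
  Real.sin_pos_of_pos_of_lt_pi (by positivity) (by nlinarith [Real.pi_pos])

theorem integrableOn_rpow_div_rpow_one_sub {s : ℝ} (hs0 : 0 < s) (hs1 : s < 1) :
    IntegrableOn (fun t : ℝ => t ^ (s - 1) / (1 - t) ^ s) (Ioo 0 1) := by
  -- A non-integrable function has Bochner integral `0` by convention, whereas the value just
  -- computed is positive.
  by_contra h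
  have h1 := integral_rpow_div_rpow_one_sub hs0 hs1
  rw [integral_undef h] at h1
  exact (div_pos Real.pi_pos (sin_pi_mul_pos hs0 hs1)).ne h1

/-- The weighted harmonic mean `1 !_t x = ((1 - t) + t x⁻¹)⁻¹` of positive numbers. -/
noncomputable def harmFun (t x : ℝ) : ℝ := x / ((1 - t) * x + t)

theorem harmFun_denom_pos {t x : ℝ} (ht : t ∈ Ioo (0 : ℝ) 1) (hx : 0 < x) :
    0 < (1 - t) * x + t :=
  add_pos (mul_pos (sub_pos.mpr ht.2) hx) ht.1

theorem harmFun_pos {t x : ℝ} (ht : t ∈ Ioo (0 : ℝ) 1) (hx : 0 < x) : 0 < harmFun t x :=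
  div_pos hx (harmFun_denom_pos ht hx)

/-- A bound free of `t`, used to dominate the integrand on the spectrum. -/
theorem harmFun_le {t x : ℝ} (ht : t ∈ Ioo (0 : ℝ) 1) (hx : 0 < x) : harmFun t x ≤ x + 1 := by
  rw [harmFun, div_le_iff₀ (harmFun_denom_pos ht hx)]
  nlinarith [mul_pos (sub_pos.mpr ht.2) hx, ht.1, ht.2, mul_pos ht.1 hx,
    mul_pos (sub_pos.mpr ht.2) (mul_pos hx hx)]

theorem harmFun_mul {t x : ℝ} (ht : t ∈ Ioo (0 : ℝ) 1) (hx : 0 < x) :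
    harmFun t x * ((1 - t) + t * x⁻¹) = 1 := by
  have e : (1 - t) + t * x⁻¹ = ((1 - t) * x + t) / x := by field_simp
  rw [harmFun, e, div_mul_div_cancel₀ (harmFun_denom_pos ht hx).ne', div_self hx.ne']

/-- Substitute `v = t / D` with `D = (1-t)x + t`, a bijection of `(0,1)`. Since `1 - v = (1-t)x / D`
and `dv = x / D² dt`, the weight `v^(s-1) (1-v)^(-s) dv` becomes `x^(-s) t^(s-1) (1-t)^(-s) h_t(x)
dt`. -/
theorem integral_rpow_mul_harmFun {s x : ℝ} (hs0 : 0 < s) (hs1 : s < 1) (hx : 0 < x) :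
    ∫ t in Ioo (0 : ℝ) 1, t ^ (s - 1) / (1 - t) ^ s * harmFun t x
      = Real.pi / Real.sin (Real.pi * s) * x ^ s := by
  set f : ℝ → ℝ := fun t => t / ((1 - t) * x + t) with hf
  have himg : f '' Ioo 0 1 = Ioo 0 1 := by
    ext v
    constructor
    · rintro ⟨t, ht, rfl⟩
      have hd := harmFun_denom_pos ht hx
      refine ⟨div_pos ht.1 hd, (div_lt_one hd).mpr ?_⟩
      linarith [mul_pos (sub_pos.mpr ht.2) hx]
    · intro hv
      have h1 : 0 < 1 - v := sub_pos.mpr hv.2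
      have hd : 0 < (1 - v) + v * x := add_pos h1 (mul_pos hv.1 hx)
      -- The preimage comes from solving `v ((1-t)x + t) = t` for `t`.
      refine ⟨v * x / ((1 - v) + v * x), ⟨div_pos (mul_pos hv.1 hx) hd, ?_⟩, ?_⟩
      · rw [div_lt_one hd]; linarith
      · have e : (1 - v * x / ((1 - v) + v * x)) * x + v * x / ((1 - v) + v * x)
            = x / ((1 - v) + v * x) := by field_simp; ring
        simp only [hf, e]
        field_simp
  have hder : ∀ t ∈ Ioo (0 : ℝ) 1,
      HasDerivWithinAt f (x / ((1 - t) * x + t) ^ 2) (Ioo 0 1) t := by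
    intro t ht
    have hd := (harmFun_denom_pos ht hx).ne'
    have h1 : HasDerivAt (fun t : ℝ => (1 - t) * x + t) ((0 - 1) * x + 1) t :=
      (((hasDerivAt_const t 1).sub (hasDerivAt_id t)).mul_const x).add (hasDerivAt_id t)
    have h2 := (hasDerivAt_id t).div h1 hd
    refine (h2.congr_deriv ?_).hasDerivWithinAt
    simp only [id]
    congr 1
    ring
  have hinj : InjOn f (Ioo 0 1) := by
    intro a ha b hb hab
    have h1 := harmFun_denom_pos ha hx
    have h2 := harmFun_denom_pos hb hx
    simp only [hf] at hab
    rw [div_eq_div_iff h1.ne' h2.ne'] at hab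
    have : x * (a - b) = 0 := by linarith
    rcases mul_eq_zero.mp this with h | h
    · exact absurd h hx.ne'
    · linarith
  have h := integral_image_eq_integral_abs_deriv_smul measurableSet_Ioo hder hinj
    (fun t => t ^ (s - 1) / (1 - t) ^ s)
  rw [himg, integral_rpow_div_rpow_one_sub hs0 hs1] at h
  rw [h, ← integral_mul_const]
  refine setIntegral_congr_fun measurableSet_Ioo fun t ht => ?_
  have hd := harmFun_denom_pos ht hx
  have h1 : 0 < 1 - t := sub_pos.mpr ht.2
  have e : 1 - f t = (1 - t) * x / ((1 - t) * x + t) := by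
    simp only [hf]; field_simp; ring
  simp only [smul_eq_mul, e]
  simp only [hf, harmFun]
  rw [abs_of_pos (by positivity), Real.div_rpow ht.1.le hd.le, Real.div_rpow (by positivity) hd.le,
    Real.mul_rpow h1.le hx.le, Real.rpow_sub hd, Real.rpow_one]
  have p1 := Real.rpow_pos_of_pos hd s
  have p2 := Real.rpow_pos_of_pos hx s
  have p3 := Real.rpow_pos_of_pos h1 s
  field_simp

theorem integral_rpow_eq_logMeanFun {x : ℝ} (hx : 0 < x) :
    ∫ t in Ioc (0 : ℝ) 1, x ^ t = logMeanFun x := by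
  rw [← intervalIntegral.integral_of_le zero_le_one, logMeanFun]
  split_ifs with h
  · simp [h]
  · have hl : Real.log x ≠ 0 := Real.log_ne_zero_of_pos_of_ne_one hx h
    have hd : ∀ t ∈ uIcc (0 : ℝ) 1, HasDerivAt (fun t : ℝ => x ^ t / Real.log x) (x ^ t) t := by
      intro t _
      have h1 := (Real.hasStrictDerivAt_const_rpow hx t).hasDerivAt.div_const (Real.log x)
      rwa [mul_div_cancel_right₀ _ hl] at h1
    rw [intervalIntegral.integral_eq_sub_of_hasDerivAt hd
      ((Real.continuous_const_rpow hx.ne').intervalIntegrable _ _)]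
    simp [sub_div]

end ScalarIntegrals

/-! ### Extended integrals of nonnegative real functions. -/

section Extended

/-- The negative part vanishes and the positive part has finite integral, so neither the convention
for `∞ - ∞` nor the value `⊤` intervenes. -/
theorem extIntegral_coe_of_nonneg {s : Set ℝ} (hs : MeasurableSet s) {φ : ℝ → EReal} {f : ℝ → ℝ}
    (hφ : ∀ t ∈ s, φ t = (f t : EReal)) (hf : IntegrableOn f s) (h0 : ∀ t ∈ s, 0 ≤ f t) :
    extIntegral s φ = ((∫ t in s, f t : ℝ) : EReal) := by
  have h1 : ∫⁻ t in s, (φ t).toENNReal = ENNReal.ofReal (∫ t in s, f t) := by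
    rw [ofReal_integral_eq_lintegral_ofReal hf ((ae_restrict_iff' hs).mpr (.of_forall h0))]
    exact setLIntegral_congr_fun hs fun t ht => by simp only [hφ t ht, EReal.real_coe_toENNReal]
  have h2 : ∫⁻ t in s, (-φ t).toENNReal = 0 := by
    rw [← lintegral_zero (μ := volume.restrict s)]
    refine setLIntegral_congr_fun hs fun t ht => ?_
    simp only [hφ t ht, ← EReal.coe_neg, EReal.real_coe_toENNReal]
    exact ENNReal.ofReal_of_nonpos (neg_nonpos.mpr (h0 t ht))
  rw [extIntegral, h1, h2, if_neg ENNReal.ofReal_ne_top, EReal.coe_ennreal_ofReal,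
    max_eq_left (setIntegral_nonneg hs h0), EReal.coe_ennreal_zero, sub_zero]

end Extended

/-! ### Fenchel conjugates of quadratic functionals. -/

section Conjugates

variable {𝕜 H : Type*} [RCLike 𝕜] [NormedAddCommGroup H] [InnerProductSpace 𝕜 H]

theorem re_inner_sub_quad_le {C D : H →L[𝕜] H} (hC : C.IsPositive) (hCD : C * D = 1) (a x : H) :
    RCLike.re (inner 𝕜 a x) - 1 / 2 * RCLike.re (inner 𝕜 (C x) x)
      ≤ 1 / 2 * RCLike.re (inner 𝕜 (D a) a) := by
  have ha : C (D a) = a := by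
    have := congr($hCD a)
    simpa using this
  set z := D a
  -- Completing the square: the difference of the two sides is `(1/2) Re ⟨C(x-z), x-z⟩`, with `z = D
  -- a` the maximizer.
  have h1 := hC.re_inner_nonneg_left (x - z)
  have h2 : inner 𝕜 (C x) z = inner 𝕜 x a := by
    rw [← ha]; exact hC.isSymmetric x z
  have h3 : RCLike.re (inner 𝕜 z a) = RCLike.re (inner 𝕜 a z) := inner_re_symm _ _
  have h4 : RCLike.re (inner 𝕜 x a) = RCLike.re (inner 𝕜 a x) := inner_re_symm _ _
  simp only [map_sub, inner_sub_left, inner_sub_right, ha, h2] at h1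
  linarith

theorem re_inner_sub_quad_eq {C D : H →L[𝕜] H} (hCD : C * D = 1) (a : H) :
    RCLike.re (inner 𝕜 a (D a)) - 1 / 2 * RCLike.re (inner 𝕜 (C (D a)) (D a))
      = 1 / 2 * RCLike.re (inner 𝕜 (D a) a) := by
  have ha : C (D a) = a := by
    have := congr($hCD a)
    simpa using this
  have h3 : RCLike.re (inner 𝕜 (D a) a) = RCLike.re (inner 𝕜 a (D a)) := inner_re_symm _ _
  rw [ha]
  linarith

theorem isStrictlyPositive_of_isUnit {A : H →L[𝕜] H} (hA : A.IsPositive) (hA' : IsUnit A) :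
    IsStrictlyPositive A :=
  IsStrictlyPositive.iff_of_unital.mpr ⟨(ContinuousLinearMap.nonneg_iff_isPositive A).mpr hA, hA'⟩

variable [CompleteSpace H]

theorem conjugate_quadFun {C D : H →L[𝕜] H} (hC : C.IsPositive) (hCD : C * D = 1) (a : H) :
    conjugate 𝕜 (quadFun C) (InnerProductSpace.toDual 𝕜 H a) = quadFun D a := by
  refine le_antisymm (iSup_le fun x => ?_) (le_iSup_of_le (D a) ?_)
  · rw [InnerProductSpace.toDual_apply_apply, quadFun, quadFun, ← EReal.coe_sub, EReal.coe_le_coe_iff]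
    exact re_inner_sub_quad_le hC hCD a x
  · rw [InnerProductSpace.toDual_apply_apply, quadFun, quadFun, ← EReal.coe_sub, EReal.coe_le_coe_iff]
    exact (re_inner_sub_quad_eq hCD a).ge

/-- The Riesz map turns the supremum over the dual into one over `H`, and the symmetry of `Re ⟨a,
x⟩` makes it an ordinary conjugate of `quadFun C`. -/
theorem dualConjugate_eq_quadFun {C D : H →L[𝕜] H} (hC : C.IsPositive) (hCD : C * D = 1)
    {h : StrongDual 𝕜 H → EReal}
    (hh : ∀ a, h (InnerProductSpace.toDual 𝕜 H a) = quadFun C a) (x : H) :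
    dualConjugate 𝕜 h x = quadFun D x := by
  rw [← conjugate_quadFun hC hCD, dualConjugate, conjugate,
    ← (InnerProductSpace.toDual 𝕜 H).surjective.iSup_comp]
  refine iSup_congr fun a => ?_
  rw [hh, InnerProductSpace.toDual_apply_apply, InnerProductSpace.toDual_apply_apply, inner_re_symm]

/-- Inverses enter as explicit right inverses. `E` is constrained only through its real quadratic
form, which is all that `quadFun` sees. -/
theorem funHarmMean_quadFun {A B A' B' E M : H →L[𝕜] H} {t : ℝ} (ht : t ∈ Ioo (0 : ℝ) 1)
    (hA : A.IsPositive) (hB : B.IsPositive) (hAA' : A * A' = 1) (hBB' : B * B' = 1)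
    (hE : E.IsPositive) (hEM : E * M = 1)
    (h : ∀ a, RCLike.re (inner 𝕜 (E a) a)
      = (1 - t) * RCLike.re (inner 𝕜 (A' a) a) + t * RCLike.re (inner 𝕜 (B' a) a)) :
    funHarmMean 𝕜 (quadFun A) (quadFun B) t = quadFun M := by
  ext1 x
  rw [funHarmMean, if_neg ht.1.ne', if_neg ht.2.ne]
  refine dualConjugate_eq_quadFun hE hEM (fun a => ?_) x
  rw [conjugate_quadFun hA hAA', conjugate_quadFun hB hBB', quadFun, quadFun, quadFun, h,
    ← EReal.coe_mul, ← EReal.coe_mul, ← EReal.coe_add]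
  congr 1
  ring

end Conjugates

/-! ### Reduction of the harmonic mean to one operator by congruence. -/

section Operators

variable {𝕜 H : Type*} [RCLike 𝕜] [NormedAddCommGroup H] [InnerProductSpace 𝕜 H]
  [CompleteSpace H] [NormedSpace ℝ H] [IsScalarTower ℝ 𝕜 H]

/-- The operator `A^(-1/2) B A^(-1/2)`. -/
noncomputable abbrev quot (A B : H →L[𝕜] H) : H →L[𝕜] H :=
  A ^ (-(1 / 2) : ℝ) * B * A ^ (-(1 / 2) : ℝ)

/-- The operator `A^(1/2) f(A^(-1/2) B A^(-1/2)) A^(1/2)`. -/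
noncomputable def opMean (A B : H →L[𝕜] H) (f : ℝ → ℝ) : H →L[𝕜] H :=
  A ^ (1 / 2 : ℝ) * cfc f (quot A B) * A ^ (1 / 2 : ℝ)

theorem isStrictlyPositive_conj {S B : H →L[𝕜] H} (hS : IsStrictlyPositive S)
    (hB : IsStrictlyPositive B) : IsStrictlyPositive (S * B * S) := by
  refine IsStrictlyPositive.iff_of_unital.mpr ⟨?_, (hS.isUnit.mul hB.isUnit).mul hS.isUnit⟩
  exact hS.isSelfAdjoint.conjugate_nonneg hB.nonneg

theorem isStrictlyPositive_quot {A B : H →L[𝕜] H} (hA : IsStrictlyPositive A)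
    (hB : IsStrictlyPositive B) : IsStrictlyPositive (quot A B) :=
  isStrictlyPositive_conj (IsStrictlyPositive.rpow A _) hB

theorem spectrum_pos {X : H →L[𝕜] H} (hX : IsStrictlyPositive X) {x : ℝ}
    (hx : x ∈ spectrum ℝ X) : 0 < x :=
  hX.spectrum_pos hx

theorem opGeoMean_eq_opMean {A B : H →L[𝕜] H} (hA : IsStrictlyPositive A)
    (hB : IsStrictlyPositive B) (s : ℝ) : opGeoMean A B s = opMean A B fun x => x ^ s := by
  rw [opGeoMean, opMean, CFC.rpow_eq_cfc_real (isStrictlyPositive_quot hA hB).nonneg]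

theorem cfc_const_add_const_mul {X : H →L[𝕜] H} (hX : IsSelfAdjoint X) (a b : ℝ) {f : ℝ → ℝ}
    (hf : ContinuousOn f (spectrum ℝ X)) :
    cfc (fun x => a + b * f x) X = a • (1 : H →L[𝕜] H) + b • cfc f X := by
  have h1 : cfc (fun x => b * f x) X = b • cfc f X := cfc_const_mul b f X hf
  have h2 : cfc (fun x => a + b * f x) X = algebraMap ℝ (H →L[𝕜] H) a + cfc (fun x => b * f x) X :=
    cfc_const_add a (fun x => b * f x) X (continuousOn_const.mul hf) hX
  rw [h2, h1, Algebra.algebraMap_eq_smul_one]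

/-- With `P = A^(1/2)` and `Q = P⁻¹`, one has `A = P 1 P` and `B = P X P`. The inverses are `Q 1 Q`
and `Q X⁻¹ Q`, so their weighted sum `Q ((1-t) + t X⁻¹) Q` has inverse `P h_t(X) P`. -/
theorem funHarmMean_quadFun_eq {A B : H →L[𝕜] H} (hA : IsStrictlyPositive A)
    (hB : IsStrictlyPositive B) {t : ℝ} (ht : t ∈ Ioo (0 : ℝ) 1) :
    funHarmMean 𝕜 (quadFun A) (quadFun B) t = quadFun (opMean A B (harmFun t)) := by
  set P := A ^ (1 / 2 : ℝ) with hP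
  set Q := A ^ (-(1 / 2) : ℝ) with hQ
  have hPQ : P * Q = 1 := CFC.rpow_mul_rpow_neg _
  have hQP : Q * P = 1 := CFC.rpow_neg_mul_rpow _
  have hPP : P * P = A := by
    rw [hP, ← CFC.rpow_add hA.isUnit, add_halves, CFC.rpow_one A hA.nonneg]
  have hX := isStrictlyPositive_quot hA hB
  have hQsp : IsStrictlyPositive Q := IsStrictlyPositive.rpow A _
  set X := quot A B with hXdef
  have hXsa : IsSelfAdjoint X := hX.isSelfAdjoint
  have hc : ContinuousOn (fun x : ℝ => x⁻¹) (spectrum ℝ X) :=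
    continuousOn_inv₀.mono fun x hx => (spectrum_pos hX hx).ne'
  have hc2 : ContinuousOn (harmFun t) (spectrum ℝ X) :=
    continuousOn_id.div (by fun_prop) fun x hx => (harmFun_denom_pos ht (spectrum_pos hX hx)).ne'
  have hBX : B = P * X * P := by
    calc B = (P * Q) * B * (Q * P) := by rw [hPQ, hQP, one_mul, mul_one]
      _ = P * X * P := by rw [hXdef, quot]; noncomm_ring
  have hXi : X * cfc (fun x : ℝ => x⁻¹) X = 1 := by
    conv_lhs => enter [1]; rw [← cfc_id' ℝ X]
    rw [← cfc_mul _ _ X (by fun_prop) hc, ← cfc_one ℝ X]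
    exact cfc_congr fun x hx => mul_inv_cancel₀ (spectrum_pos hX hx).ne'
  have hEM : cfc (fun x : ℝ => (1 - t) + t * x⁻¹) X * cfc (harmFun t) X = 1 := by
    have hc3 : ContinuousOn (fun x : ℝ => (1 - t) + t * x⁻¹) (spectrum ℝ X) :=
      continuousOn_const.add (continuousOn_const.mul hc)
    rw [← cfc_mul _ _ X hc3 hc2, ← cfc_one ℝ X]
    exact cfc_congr fun x hx => by
      simp only [Pi.one_apply]
      rw [mul_comm]
      exact harmFun_mul ht (spectrum_pos hX hx)
  have hE : cfc (fun x : ℝ => (1 - t) + t * x⁻¹) X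
      = (1 - t) • 1 + t • cfc (fun x : ℝ => x⁻¹) X :=
    cfc_const_add_const_mul hXsa _ _ hc
  have cancel : ∀ S T : H →L[𝕜] H, S * T = 1 → (P * S * P) * (Q * T * Q) = 1 := fun S T h => by
    calc (P * S * P) * (Q * T * Q) = P * S * (P * Q) * T * Q := by noncomm_ring
      _ = P * (S * T) * Q := by rw [hPQ]; noncomm_ring
      _ = 1 := by rw [h, mul_one, hPQ]
  have cancel' : ∀ S T : H →L[𝕜] H, S * T = 1 → (Q * S * Q) * (P * T * P) = 1 := fun S T h => by
    calc (Q * S * Q) * (P * T * P) = Q * S * (Q * P) * T * P := by noncomm_ring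
      _ = Q * (S * T) * P := by rw [hQP]; noncomm_ring
      _ = 1 := by rw [h, mul_one, hQP]
  refine funHarmMean_quadFun (A' := Q * 1 * Q) (B' := Q * cfc (fun x : ℝ => x⁻¹) X * Q)
    (E := Q * cfc (fun x : ℝ => (1 - t) + t * x⁻¹) X * Q) ht
    ((ContinuousLinearMap.nonneg_iff_isPositive A).mp hA.nonneg)
    ((ContinuousLinearMap.nonneg_iff_isPositive B).mp hB.nonneg) ?_ ?_ ?_ (cancel' _ _ hEM) ?_
  · rw [← hPP]
    simpa using cancel 1 1 (one_mul 1)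
  · nth_rewrite 1 [hBX]
    exact cancel _ _ hXi
  · rw [← ContinuousLinearMap.nonneg_iff_isPositive]
    refine hQsp.isSelfAdjoint.conjugate_nonneg (cfc_nonneg fun x hx => ?_)
    have := spectrum_pos hX hx
    have := sub_pos.mpr ht.2
    have := ht.1
    positivity
  · intro a
    rw [hE]
    simp only [RCLike.real_smul_eq_coe_smul (K := 𝕜), mul_add, add_mul, mul_smul_comm,
      smul_mul_assoc, add_apply, smul_apply, inner_add_left, inner_smul_left]
    simp

end Operators

/-! ### Integration through the functional calculus. -/

section Integrals

theorem rpow_le_add_one {t x : ℝ} (ht : t ∈ Icc (0 : ℝ) 1) (hx : 0 < x) : x ^ t ≤ x + 1 := by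
  rcases le_total x 1 with h | h
  · linarith [Real.rpow_le_one hx.le h ht.1]
  · have := Real.rpow_le_rpow_of_exponent_le h ht.2
    rw [Real.rpow_one] at this
    linarith

variable {𝕜 H : Type*} [RCLike 𝕜] [NormedAddCommGroup H] [InnerProductSpace 𝕜 H]
  [NormedSpace ℝ H] [IsScalarTower ℝ 𝕜 H]

/-- The quadratic form `T ↦ (1/2) Re ⟨T x, x⟩` as a functional of the operator. -/
noncomputable def quadCLM (x : H) : (H →L[𝕜] H) →L[ℝ] ℝ :=
  LinearMap.mkContinuous
    { toFun := fun T => 1 / 2 * RCLike.re (inner 𝕜 (T x) x)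
      map_add' := fun S T => by simp [inner_add_left, mul_add]
      map_smul' := fun r T => by
        simp only [RCLike.real_smul_eq_coe_smul (K := 𝕜), smul_apply, inner_smul_left]
        simp
        ring }
    (1 / 2 * ‖x‖ ^ 2) fun T => by
      have h1 : |RCLike.re (inner 𝕜 (T x) x)| ≤ ‖T‖ * ‖x‖ * ‖x‖ :=
        ((RCLike.abs_re_le_norm _).trans (norm_inner_le_norm _ _)).trans
          (mul_le_mul_of_nonneg_right (T.le_opNorm x) (norm_nonneg x))
      simp only [LinearMap.coe_mk, AddHom.coe_mk, norm_mul, Real.norm_eq_abs]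
      rw [abs_of_pos (by norm_num : (0 : ℝ) < 1 / 2)]
      linarith

theorem quadFun_eq_quadCLM (T : H →L[𝕜] H) (x : H) :
    quadFun T x = ((quadCLM (𝕜 := 𝕜) x T : ℝ) : EReal) := rfl

variable [CompleteSpace H]

theorem exists_spectrum_add_one_le (X : H →L[𝕜] H) : ∃ M, ∀ x ∈ spectrum ℝ X, x + 1 ≤ M := by
  have h := isCompact_iff_compactSpace.mpr (isCompact_spectrum X)
  obtain ⟨M, hM⟩ := h.bddAbove
  exact ⟨M + 1, fun x hx => add_le_add_left (hM hx) 1⟩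

/-- Joint continuity and an integrable bound uniform on the spectrum let the integral pass through
`cfc`; multiplication by the fixed `A^(1/2)` on either side is bounded and linear. -/
theorem integrableOn_opMean {A B : H →L[𝕜] H} (hX : IsSelfAdjoint (quot A B)) {s : Set ℝ}
    (hs : MeasurableSet s) (f : ℝ → ℝ → ℝ) (bound : ℝ → ℝ)
    (hf : ContinuousOn (Function.uncurry f) (s ×ˢ spectrum ℝ (quot A B)))
    (hb : ∀ t ∈ s, ∀ x ∈ spectrum ℝ (quot A B), ‖f t x‖ ≤ bound t) (hi : IntegrableOn bound s) :
    IntegrableOn (fun t => opMean A B (f t)) s ∧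
      ∫ t in s, opMean A B (f t) = opMean A B fun x => ∫ t in s, f t x := by
  -- Only the norm bound is added to the existing real algebra structure, so the instance agrees
  -- with the one used by `cfc`.
  let _ : NormedAlgebra ℝ (H →L[𝕜] H) :=
    { (inferInstance : Algebra ℝ (H →L[𝕜] H)) with norm_smul_le := fun r x => norm_smul_le r x }
  have hb' : ∀ᵐ t ∂volume.restrict s, ∀ x ∈ spectrum ℝ (quot A B), ‖f t x‖ ≤ bound t :=
    (ae_restrict_iff' hs).mpr (.of_forall hb)
  have h1 : IntegrableOn (fun t => cfc (f t) (quot A B)) s :=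
    integrableOn_cfc hs f bound (quot A B) hf hb' hi.hasFiniteIntegral hX
  have h2 := cfc_setIntegral hs f bound (quot A B) hf hb' hi.hasFiniteIntegral hX
  have h3 := h1.const_mul (A ^ (1 / 2 : ℝ))
  refine ⟨h3.mul_const _, ?_⟩
  simp only [opMean]
  rw [integral_mul_const_of_integrable h3, integral_const_mul_of_integrable h1, h2]

theorem opMean_nonneg {A B : H →L[𝕜] H} (hA : IsStrictlyPositive A) {f : ℝ → ℝ}
    (hf : ∀ x ∈ spectrum ℝ (quot A B), 0 ≤ f x) : 0 ≤ opMean A B f :=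
  (IsStrictlyPositive.rpow A (1 / 2 : ℝ)).isSelfAdjoint.conjugate_nonneg (cfc_nonneg hf)

theorem quadCLM_opMean_nonneg {A B : H →L[𝕜] H} (hA : IsStrictlyPositive A) {f : ℝ → ℝ}
    (hf : ∀ x ∈ spectrum ℝ (quot A B), 0 ≤ f x) (x : H) :
    0 ≤ quadCLM (𝕜 := 𝕜) x (opMean A B f) :=
  mul_nonneg (by norm_num) (((ContinuousLinearMap.nonneg_iff_isPositive _).mp
    (opMean_nonneg hA hf)).re_inner_nonneg_left x)

theorem opMean_const_mul {A B : H →L[𝕜] H} (c : ℝ) {f : ℝ → ℝ}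
    (hf : ContinuousOn f (spectrum ℝ (quot A B))) :
    opMean A B (fun x => c * f x) = c • opMean A B f := by
  have h : cfc (fun x => c * f x) (quot A B) = c • cfc f (quot A B) := cfc_const_mul c f _ hf
  rw [opMean, opMean, h, mul_smul_comm, smul_mul_assoc]

theorem opMean_congr {A B : H →L[𝕜] H} {f g : ℝ → ℝ} (h : EqOn f g (spectrum ℝ (quot A B))) :
    opMean A B f = opMean A B g := by
  rw [opMean, opMean, cfc_congr h]

variable {A B : H →L[𝕜] H}

theorem opMean_integral_harmFun (hA : IsStrictlyPositive A) (hB : IsStrictlyPositive B) {s : ℝ}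
    (hs0 : 0 < s) (hs1 : s < 1) :
    IntegrableOn (fun t : ℝ => (t ^ (s - 1) / (1 - t) ^ s) • opMean A B (harmFun t)) (Ioo 0 1) ∧
      ∫ t in Ioo (0 : ℝ) 1, (t ^ (s - 1) / (1 - t) ^ s) • opMean A B (harmFun t)
        = (Real.pi / Real.sin (Real.pi * s)) • opGeoMean A B s := by
  have hX := isStrictlyPositive_quot hA hB
  have hpos : ∀ x ∈ spectrum ℝ (quot A B), 0 < x := fun x => spectrum_pos hX
  obtain ⟨M, hM⟩ := exists_spectrum_add_one_le (quot A B)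
  have hw : ∀ t ∈ Ioo (0 : ℝ) 1, 0 ≤ t ^ (s - 1) / (1 - t) ^ s := fun t ht =>
    div_nonneg (Real.rpow_nonneg ht.1.le _) (Real.rpow_nonneg (sub_nonneg.mpr ht.2.le) _)
  have hcont : ∀ t ∈ Ioo (0 : ℝ) 1, ContinuousOn (harmFun t) (spectrum ℝ (quot A B)) :=
    fun t ht => continuousOn_id.div (by fun_prop)
      fun x hx => (harmFun_denom_pos ht (hpos x hx)).ne'
  have hsmul : ∀ t ∈ Ioo (0 : ℝ) 1, opMean A B (fun x => t ^ (s - 1) / (1 - t) ^ s * harmFun t x)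
      = (t ^ (s - 1) / (1 - t) ^ s) • opMean A B (harmFun t) :=
    fun t ht => opMean_const_mul _ (hcont t ht)
  have hf : ContinuousOn (Function.uncurry fun t x : ℝ => t ^ (s - 1) / (1 - t) ^ s * harmFun t x)
      (Ioo 0 1 ×ˢ spectrum ℝ (quot A B)) := by
    rintro ⟨t, x⟩ ⟨ht, hx⟩
    have h1 : (1 - t) ≠ 0 := (sub_pos.mpr ht.2).ne'
    have h2 := (harmFun_denom_pos ht (hpos x hx)).ne'
    have h3 : ContinuousAt (fun p : ℝ × ℝ => p.1 ^ (s - 1)) (t, x) :=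
      continuousAt_fst.rpow_const (.inl ht.1.ne')
    have h4 : ContinuousAt (fun p : ℝ × ℝ => (1 - p.1) ^ s) (t, x) :=
      (continuousAt_const.sub continuousAt_fst).rpow_const (.inl h1)
    have h5 : ContinuousAt (fun p : ℝ × ℝ => p.2 / ((1 - p.1) * p.2 + p.1)) (t, x) :=
      continuousAt_snd.div (by fun_prop) h2
    exact ((h3.div h4 (Real.rpow_pos_of_pos (sub_pos.mpr ht.2) s).ne').mul
      h5).continuousWithinAt
  have hb : ∀ t ∈ Ioo (0 : ℝ) 1, ∀ x ∈ spectrum ℝ (quot A B),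
      ‖t ^ (s - 1) / (1 - t) ^ s * harmFun t x‖ ≤ t ^ (s - 1) / (1 - t) ^ s * M := by
    intro t ht x hx
    rw [norm_mul, Real.norm_of_nonneg (hw t ht), Real.norm_of_nonneg (harmFun_pos ht (hpos x hx)).le]
    exact mul_le_mul_of_nonneg_left ((harmFun_le ht (hpos x hx)).trans (hM x hx)) (hw t ht)
  obtain ⟨h1, h2⟩ := integrableOn_opMean hX.isSelfAdjoint measurableSet_Ioo
    (fun t x => t ^ (s - 1) / (1 - t) ^ s * harmFun t x)
    -- The weight is singular at both endpoints but integrable; `M` bounds `x + 1` on the compact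
    -- spectrum.
    (fun t => t ^ (s - 1) / (1 - t) ^ s * M) hf hb
    ((integrableOn_rpow_div_rpow_one_sub hs0 hs1).mul_const M)
  refine ⟨h1.congr_fun hsmul measurableSet_Ioo, ?_⟩
  rw [← setIntegral_congr_fun measurableSet_Ioo hsmul, h2, opGeoMean_eq_opMean hA hB,
    ← opMean_const_mul]
  · exact opMean_congr fun x hx => integral_rpow_mul_harmFun hs0 hs1 (hpos x hx)
  · exact continuousOn_id.rpow_const fun x hx => .inl (hpos x hx).ne'

theorem opMean_integral_rpow (hA : IsStrictlyPositive A) (hB : IsStrictlyPositive B) :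
    IntegrableOn (fun t : ℝ => opGeoMean A B t) (Ioc 0 1) ∧
      opLogMean A B = opMean A B logMeanFun := by
  have hX := isStrictlyPositive_quot hA hB
  have hpos : ∀ x ∈ spectrum ℝ (quot A B), 0 < x := fun x => spectrum_pos hX
  obtain ⟨M, hM⟩ := exists_spectrum_add_one_le (quot A B)
  have hf : ContinuousOn (Function.uncurry fun t x : ℝ => x ^ t)
      (Ioc 0 1 ×ˢ spectrum ℝ (quot A B)) := by
    rintro ⟨t, x⟩ ⟨ht, hx⟩
    exact (continuousAt_snd.rpow continuousAt_fst (.inl (hpos x hx).ne')).continuousWithinAt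
  have hb : ∀ t ∈ Ioc (0 : ℝ) 1, ∀ x ∈ spectrum ℝ (quot A B), ‖x ^ t‖ ≤ M := by
    intro t ht x hx
    rw [Real.norm_of_nonneg (Real.rpow_nonneg (hpos x hx).le _)]
    exact (rpow_le_add_one ⟨ht.1.le, ht.2⟩ (hpos x hx)).trans (hM x hx)
  obtain ⟨h1, h2⟩ := integrableOn_opMean hX.isSelfAdjoint measurableSet_Ioc
    (fun t x => x ^ t) (fun _ => M) hf hb (integrableOn_const (s := Ioc (0 : ℝ) 1) (by simp))
  simp only [← opGeoMean_eq_opMean hA hB] at h1 h2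
  refine ⟨h1, ?_⟩
  rw [opLogMean, intervalIntegral.integral_of_le zero_le_one, h2]
  exact opMean_congr fun x hx => integral_rpow_eq_logMeanFun (hpos x hx)

theorem funGeoMean_quadFun (hA : IsStrictlyPositive A) (hB : IsStrictlyPositive B) {s : ℝ}
    (hs : s ∈ Ioo (0 : ℝ) 1) :
    funGeoMean 𝕜 (quadFun A) (quadFun B) s = quadFun (opGeoMean A B s) := by
  have hX := isStrictlyPositive_quot hA hB
  ext1 x
  obtain ⟨h1, h2⟩ := opMean_integral_harmFun hA hB hs.1 hs.2
  have h3 : extIntegral (Ioo 0 1) (fun t => ((t ^ (s - 1) / (1 - t) ^ s : ℝ) : EReal)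
        * funHarmMean 𝕜 (quadFun A) (quadFun B) t x)
      = ((∫ t in Ioo (0 : ℝ) 1, quadCLM (𝕜 := 𝕜) x
        ((t ^ (s - 1) / (1 - t) ^ s) • opMean A B (harmFun t)) : ℝ) : EReal) := by
    refine extIntegral_coe_of_nonneg measurableSet_Ioo (fun t ht => ?_)
      ((quadCLM (𝕜 := 𝕜) x).integrable_comp h1) fun t ht => ?_
    · rw [funHarmMean_quadFun_eq hA hB ht, quadFun_eq_quadCLM, ← EReal.coe_mul, map_smul,
        smul_eq_mul]
    · rw [map_smul]
      exact mul_nonneg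
        (div_nonneg (Real.rpow_nonneg ht.1.le _) (Real.rpow_nonneg (sub_nonneg.mpr ht.2.le) _))
        (quadCLM_opMean_nonneg hA (fun y hy => (harmFun_pos ht (spectrum_pos hX hy)).le) x)
  rw [funGeoMean, if_neg hs.1.ne', if_neg hs.2.ne, h3,
    -- The prefactor `sin(πs)/π` cancels the Beta constant `π/sin(πs)`.
    ContinuousLinearMap.integral_comp_comm _ h1, h2, map_smul, ← EReal.coe_mul, smul_eq_mul,
    ← mul_assoc, div_mul_div_cancel₀ Real.pi_ne_zero, div_self (sin_pi_mul_pos hs.1 hs.2).ne',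
    one_mul, quadFun_eq_quadCLM]

/-- Only `t` in the open interval matters on the functional side, so the endpoint conventions of
`funGeoMean` play no role; the operator integral over `(0,1]` differs by a null set. -/
theorem funLogMean_quadFun (hA : IsStrictlyPositive A) (hB : IsStrictlyPositive B) :
    funLogMean 𝕜 (quadFun A) (quadFun B) = quadFun (opLogMean A B) := by
  have hX := isStrictlyPositive_quot hA hB
  have h1 : IntegrableOn (fun t : ℝ => opGeoMean A B t) (Ioo 0 1) :=
    (opMean_integral_rpow hA hB).1.mono_set Ioo_subset_Ioc_self
  ext1 x
  rw [funLogMean, extIntegral_coe_of_nonneg (f := fun t => quadCLM (𝕜 := 𝕜) x (opGeoMean A B t))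
    measurableSet_Ioo (fun t ht => by rw [funGeoMean_quadFun hA hB ht, quadFun_eq_quadCLM])
    ((quadCLM (𝕜 := 𝕜) x).integrable_comp h1), ContinuousLinearMap.integral_comp_comm _ h1,
    opLogMean, intervalIntegral.integral_of_le zero_le_one, integral_Ioc_eq_integral_Ioo,
    quadFun_eq_quadCLM]
  -- What remains is nonnegativity of the integrand, required to evaluate the extended integral.
  intro t _
  rw [opGeoMean_eq_opMean hA hB]
  exact quadCLM_opMean_nonneg hA (fun y hy => Real.rpow_nonneg (spectrum_pos hX hy).le t) x

end Integrals

end LogMean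

theorem mainTheorem3 {𝕜 : Type*} [RCLike 𝕜] {H : Type*} [NormedAddCommGroup H]
    [InnerProductSpace 𝕜 H] [CompleteSpace H] [NormedSpace ℝ H] [IsScalarTower ℝ 𝕜 H]
    (A B : H →L[𝕜] H) (hA : A.IsPositive) (hA' : IsUnit A) (hB : B.IsPositive) (hB' : IsUnit B) :
    LogMean.funLogMean 𝕜 (LogMean.quadFun A) (LogMean.quadFun B)
        = LogMean.quadFun (LogMean.opLogMean A B) ∧
      IntervalIntegrable (fun t : ℝ => LogMean.opGeoMean A B t) MeasureTheory.volume 0 1 ∧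
      LogMean.opLogMean A B
        = A ^ (1 / 2 : ℝ)
          * cfc LogMean.logMeanFun (A ^ (-(1 / 2) : ℝ) * B * A ^ (-(1 / 2) : ℝ))
          * A ^ (1 / 2 : ℝ) := by
  have hA := LogMean.isStrictlyPositive_of_isUnit hA hA'
  have hB := LogMean.isStrictlyPositive_of_isUnit hB hB'
  exact ⟨LogMean.funLogMean_quadFun hA hB,
    (intervalIntegrable_iff_integrableOn_Ioc_of_le zero_le_one).mpr
      (LogMean.opMean_integral_rpow hA hB).1,
    (LogMean.opMean_integral_rpow hA hB).2⟩
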